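/- Fix a real number $a\in(0,2]$. For each integer $n\ge 2$, let $\nu_{n,a}$ be the number of complex roots of the trinomial $x^n-ax-1$, counted with multiplicity, whose modulus is greater than $1$. Then \[ \lim_{n\to\infty}\frac{\nu_{n,a}}{n}=\frac{1}{\pi}\arccos\left(-\frac a2\right). \] -/

import Mathlib

open Polynomial Filter Topology

noncomputable section

/-- The trinomial `x ^ n - a x - 1` with real parameter `a`, as a complex polynomial. -/
def trinomial (n : ℕ) (a : ℝ) : ℂ[X] :=
  X ^ n - C (a : ℂ) * X - 1

/-- The number of complex roots of `x ^ n - a x - 1`, counted with multiplicity, of modulus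
greater than `1`. -/
def nu (n : ℕ) (a : ℝ) : ℕ :=
  Multiset.card ((trinomial n a).roots.filter fun z : ℂ => 1 < ‖z‖)

end

/-!
The power sums `∑ z ^ k` over the roots of `x ^ n - a x - 1` vanish for `1 ≤ k ≤ n - 2`, by Newton's
identities. The moduli of the roots concentrate at `1`: the equation `z ^ n = 1 + a z` gives
`‖z‖ ≤ 1 + O(1 / n)`, and since the product of the moduli is `1`, they cannot be much smaller
than `1` on average. By Weyl's criterion the roots are therefore asymptotically equidistributed on
the unit circle. Finally, a root satisfies `1 < ‖z‖` exactly when `1 < ‖1 + a z‖`; this condition no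
longer depends on `n` and cuts out an arc of the circle of half-angle `arccos (-a / 2)`.
-/

open MeasureTheory Real

section WeakConvergence

variable {ι : Type*} {l : Filter ι}

theorem tendsto_probabilityMeasure_of_dense_span {𝕜 X : Type*} [RCLike 𝕜]
    [TopologicalSpace X] [CompactSpace X] [MeasurableSpace X] [BorelSpace X] {D : Set C(X, 𝕜)}
    (hD : (Submodule.span 𝕜 D).topologicalClosure = ⊤)
    {μ : ι → ProbabilityMeasure X} {ν : ProbabilityMeasure X}
    (h : ∀ f ∈ D, Tendsto (fun i => ∫ x, f x ∂(μ i : Measure X)) l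
      (𝓝 (∫ x, f x ∂(ν : Measure X)))) :
    Tendsto μ l (𝓝 ν) := by
  have integrable (ρ : ProbabilityMeasure X) (f : C(X, 𝕜)) : Integrable f (ρ : Measure X) :=
    (BoundedContinuousFunction.mkOfCompact f).integrable _
  have lipschitz (ρ : ProbabilityMeasure X) :
      LipschitzWith 1 fun f : C(X, 𝕜) => ∫ x, f x ∂(ρ : Measure X) := by
    refine LipschitzWith.of_dist_le_mul fun f g => ?_
    rw [dist_eq_norm, ← integral_sub (integrable ρ f) (integrable ρ g), NNReal.coe_one, one_mul]
    simpa using norm_integral_le_of_norm_le_const (μ := (ρ : Measure X))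
      (.of_forall fun x => (dist_eq_norm (f x) (g x)).ge.trans (ContinuousMap.dist_apply_le_dist x))
  have closed : IsClosed {f : C(X, 𝕜) | Tendsto (fun i => ∫ x, f x ∂(μ i : Measure X)) l
      (𝓝 (∫ x, f x ∂(ν : Measure X)))} :=
    (LipschitzWith.uniformEquicontinuous _ 1 fun i => lipschitz (μ i)).equicontinuous
      |>.isClosed_setOfPred_tendsto (lipschitz ν).continuous
  have span_le (f : C(X, 𝕜)) (hf : f ∈ Submodule.span 𝕜 D) :
      Tendsto (fun i => ∫ x, f x ∂(μ i : Measure X)) l (𝓝 (∫ x, f x ∂(ν : Measure X))) := by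
    induction hf using Submodule.span_induction with
    | mem f hf => exact h f hf
    | zero => simp [tendsto_const_nhds]
    | add f g _ _ hf hg =>
      simpa [integral_add (integrable _ f) (integrable _ g)] using hf.add hg
    | smul c f _ hf => simpa [integral_const_mul] using hf.const_mul c
  refine (ProbabilityMeasure.tendsto_iff_forall_integral_rclike_tendsto 𝕜).2 fun f => ?_
  have hf : f.toContinuousMap ∈ (Submodule.span 𝕜 D).topologicalClosure := hD ▸ Submodule.mem_top
  exact closure_minimal span_le closed hf

theorem integral_fourier_haarAddCircle {T : ℝ} [hT : Fact (0 < T)] {k : ℤ} (hk : k ≠ 0) :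
    ∫ x : AddCircle T, fourier k x ∂AddCircle.haarAddCircle = 0 :=
  integral_eq_zero_of_add_right_eq_neg (fourier_add_half_inv_index hk hT.elim)

theorem tendsto_haarAddCircle_of_tendsto_integral_fourier {T : ℝ} [Fact (0 < T)]
    {μ : ι → ProbabilityMeasure (AddCircle T)}
    (h : ∀ k : ℕ, k ≠ 0 →
      Tendsto (fun i => ∫ x, fourier k x ∂(μ i : Measure (AddCircle T))) l (𝓝 0)) :
    Tendsto μ l (𝓝 ⟨AddCircle.haarAddCircle, inferInstance⟩) := by
  refine tendsto_probabilityMeasure_of_dense_span span_fourier_closure_eq_top ?_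
  rintro _ ⟨k, rfl⟩
  obtain rfl | hk := eq_or_ne k 0
  · simp [tendsto_const_nhds]
  rw [ProbabilityMeasure.coe_mk, integral_fourier_haarAddCircle hk]
  obtain ⟨m, rfl | rfl⟩ := k.eq_nat_or_neg
  · exact h m (by simpa using hk)
  · have hm := (Complex.continuous_conj.tendsto 0).comp (h m (by simpa using hk))
    simpa only [Function.comp_def, ← integral_conj, fourier_neg, map_zero] using hm

theorem tendsto_of_tendsto_map_of_tendsto_integral_dist {E : Type*} [PseudoMetricSpace E]
    [MeasurableSpace E] [BorelSpace E] [l.IsCountablyGenerated] {g : E → E} (hg : Measurable g)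
    {μ : ι → ProbabilityMeasure E} {ν : ProbabilityMeasure E}
    (hdistint : ∀ i, Integrable (fun x => dist x (g x)) (μ i : Measure E))
    (hdist : Tendsto (fun i => ∫ x, dist x (g x) ∂(μ i : Measure E)) l (𝓝 0))
    (hmap : Tendsto (fun i => (μ i).map hg.aemeasurable) l (𝓝 ν)) :
    Tendsto μ l (𝓝 ν) := by
  rw [tendsto_iff_forall_lipschitz_integral_tendsto] at hmap ⊢
  rintro f ⟨C, hC⟩ ⟨L, hL⟩
  have integrable (ρ : ProbabilityMeasure E) : Integrable f (ρ : Measure E) :=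
    (BoundedContinuousFunction.mkOfBound ⟨f, hL.continuous⟩ C hC).integrable _
  have bound (i : ι) : dist (∫ x, f x ∂(μ i : Measure E))
      (∫ x, f x ∂((μ i).map hg.aemeasurable : Measure E))
        ≤ L * ∫ x, dist x (g x) ∂(μ i : Measure E) := by
    have integrable_comp : Integrable (fun x => f (g x)) (μ i : Measure E) :=
      (integrable ((μ i).map hg.aemeasurable)).comp_measurable hg
    rw [ProbabilityMeasure.toMeasure_map, integral_map hg.aemeasurable
      hL.continuous.aestronglyMeasurable, dist_eq_norm,
      ← integral_sub (integrable (μ i)) integrable_comp, ← integral_const_mul]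
    exact norm_integral_le_of_norm_le ((hdistint i).const_mul _)
      (.of_forall fun x => hL.dist_le_mul _ _)
  refine (tendsto_iff_of_dist (squeeze_zero (fun _ => dist_nonneg) bound ?_)).2
    (hmap f ⟨C, hC⟩ ⟨L, hL⟩)
  simpa using hdist.const_mul (L : ℝ)

end WeakConvergence

theorem integrable_of_ae_norm_le {E F : Type*} [NormedAddCommGroup E] [ProperSpace E]
    [MeasurableSpace E] [OpensMeasurableSpace E] [NormedAddCommGroup F] {μ : Measure E}
    [IsFiniteMeasure μ] {R : ℝ} {f : E → F} (hf : Continuous f) (hR : ∀ᵐ x ∂μ, ‖x‖ ≤ R) :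
    Integrable f μ := by
  obtain ⟨C, hC⟩ := (isCompact_closedBall (0 : E) R).exists_bound_of_continuousOn hf.continuousOn
  exact .of_bound hf.aestronglyMeasurable C (hR.mono fun x hx => hC x (by simpa using hx))

section UnitCircle

local instance : Fact (0 < 2 * π) := ⟨two_pi_pos⟩

theorem measurable_toCircle {T : ℝ} : Measurable fun θ : AddCircle T => (θ.toCircle : ℂ) :=
  (continuous_subtype_val.comp AddCircle.continuous_toCircle).measurable

/-- The uniform probability measure on the unit circle, as a measure on the plane. -/
noncomputable def unitCircleMeasure : ProbabilityMeasure ℂ :=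
  ProbabilityMeasure.map ⟨AddCircle.haarAddCircle (T := 2 * π), inferInstance⟩
    measurable_toCircle.aemeasurable

/-- The argument of `z` modulo `2 * π`: the radial projection of the plane to the circle, with the
junk value `0` at `z = 0`. -/
noncomputable def argMod (z : ℂ) : AddCircle (2 * π) := (Complex.arg z : ℝ)

theorem measurable_argMod : Measurable argMod :=
  AddCircle.measurable_mk'.comp Complex.measurable_arg

theorem norm_mul_toCircle_argMod (z : ℂ) : (‖z‖ : ℂ) * (argMod z).toCircle = z := by
  rw [argMod, AddCircle.toCircle_apply_mk, div_self two_pi_pos.ne', one_mul, Circle.coe_exp,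
    Complex.norm_mul_exp_arg_mul_I]

theorem norm_pow_sub_toCircle_argMod_pow (z : ℂ) (k : ℕ) :
    ‖z ^ k - ((argMod z).toCircle : ℂ) ^ k‖ = |‖z‖ ^ k - 1| := by
  nth_rw 1 [← norm_mul_toCircle_argMod z]
  rw [mul_pow, ← sub_one_mul, norm_mul, norm_pow ((argMod z).toCircle : ℂ),
    Circle.norm_coe, one_pow, mul_one]
  exact_mod_cast Complex.norm_real (‖z‖ ^ k - 1)

variable {ι : Type*} {l : Filter ι} {μ : ι → ProbabilityMeasure ℂ} {R : ℝ}

theorem tendsto_integral_argMod_pow (hR : ∀ i, ∀ᵐ z ∂(μ i : Measure ℂ), ‖z‖ ≤ R)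
    (hnorm : Tendsto (fun i => ∫ z, |‖z‖ - 1| ∂(μ i : Measure ℂ)) l (𝓝 0)) {k : ℕ}
    (hpow : Tendsto (fun i => ∫ z, z ^ k ∂(μ i : Measure ℂ)) l (𝓝 0)) :
    Tendsto (fun i => ∫ z, ((argMod z).toCircle : ℂ) ^ k ∂(μ i : Measure ℂ)) l (𝓝 0) := by
  have hmeas : Measurable fun z => ((argMod z).toCircle : ℂ) ^ k :=
    (measurable_toCircle.comp measurable_argMod).pow_const k
  have bound (i : ι) : dist (∫ z, ((argMod z).toCircle : ℂ) ^ k ∂(μ i : Measure ℂ))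
      (∫ z, z ^ k ∂(μ i : Measure ℂ)) ≤
        (∫ z, |‖z‖ - 1| ∂(μ i : Measure ℂ)) * (k * (max R 1) ^ (k - 1)) := by
    rw [dist_comm, dist_eq_norm, ← integral_sub (integrable_of_ae_norm_le (by fun_prop) (hR i))
      (.of_bound hmeas.aestronglyMeasurable 1 (by simp [Circle.norm_coe])), ← integral_mul_const]
    refine norm_integral_le_of_norm_le
      ((integrable_of_ae_norm_le (by fun_prop) (hR i)).mul_const _) ?_
    filter_upwards [hR i] with z hz
    calc ‖z ^ k - ((argMod z).toCircle : ℂ) ^ k‖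
        = |‖z‖ ^ k - 1 ^ k| := by rw [norm_pow_sub_toCircle_argMod_pow, one_pow]
      _ ≤ |‖z‖ - 1| * k * max |‖z‖| |1| ^ (k - 1) := abs_pow_sub_pow_le ..
      _ ≤ |‖z‖ - 1| * (k * max R 1 ^ (k - 1)) := by
        rw [abs_norm, abs_one, mul_assoc]
        gcongr
  refine (tendsto_iff_of_dist (squeeze_zero (fun _ => dist_nonneg) bound ?_)).2 hpow
  simpa using hnorm.mul_const _

theorem tendsto_unitCircleMeasure [l.IsCountablyGenerated]
    (hR : ∀ i, ∀ᵐ z ∂(μ i : Measure ℂ), ‖z‖ ≤ R)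
    (hnorm : Tendsto (fun i => ∫ z, |‖z‖ - 1| ∂(μ i : Measure ℂ)) l (𝓝 0))
    (hpow : ∀ k ≠ 0, Tendsto (fun i => ∫ z, z ^ k ∂(μ i : Measure ℂ)) l (𝓝 0)) :
    Tendsto μ l (𝓝 unitCircleMeasure) := by
  have hdist (z : ℂ) : dist z ((argMod z).toCircle : ℂ) = |‖z‖ - 1| := by
    simpa [dist_eq_norm] using norm_pow_sub_toCircle_argMod_pow z 1
  have hargs : Tendsto (fun i => (μ i).map measurable_argMod.aemeasurable) l
      (𝓝 ⟨AddCircle.haarAddCircle, inferInstance⟩) := by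
    refine tendsto_haarAddCircle_of_tendsto_integral_fourier fun k hk => ?_
    refine (tendsto_integral_argMod_pow hR hnorm (hpow k hk)).congr fun i => ?_
    rw [ProbabilityMeasure.toMeasure_map, integral_map measurable_argMod.aemeasurable
      (map_continuous _).aestronglyMeasurable]
    simp [fourier_apply, AddCircle.toCircle_nsmul]
  refine tendsto_of_tendsto_map_of_tendsto_integral_dist
    (measurable_toCircle.comp measurable_argMod) ?_ ?_ ?_
  · simpa only [Function.comp_def, hdist] using
      fun i => integrable_of_ae_norm_le (by fun_prop) (hR i)
  · simpa only [Function.comp_def, hdist] using hnorm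
  · have hcircle := ProbabilityMeasure.tendsto_map_of_tendsto_of_continuous _ _ hargs
      (continuous_subtype_val.comp AddCircle.continuous_toCircle)
    refine hcircle.congr fun i => Subtype.ext ?_
    exact Measure.map_map measurable_toCircle measurable_argMod

theorem coe_unitCircleMeasure : (unitCircleMeasure : Measure ℂ) =
    AddCircle.haarAddCircle.map fun θ : AddCircle (2 * π) => (θ.toCircle : ℂ) :=
  rfl

theorem unitCircleMeasure_apply {s : Set ℂ} (hs : MeasurableSet s) :
    (unitCircleMeasure : Measure ℂ) s =
      volume ({θ : ℝ | (Circle.exp θ : ℂ) ∈ s} ∩ Set.Ioc (-π) π) / ENNReal.ofReal (2 * π) := by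
  have hpre : QuotientAddGroup.mk ⁻¹' ((fun θ : AddCircle (2 * π) => (θ.toCircle : ℂ)) ⁻¹' s) =
      {θ : ℝ | (Circle.exp θ : ℂ) ∈ s} := by
    ext θ
    have : (AddCircle.toCircle (θ : AddCircle (2 * π)) : ℂ) = Circle.exp θ := by
      rw [AddCircle.toCircle_apply_mk, div_self two_pi_pos.ne', one_mul]
    simp only [Set.mem_preimage, Set.mem_ofPred_eq, ← this]
  have hvol := AddCircle.add_projection_respects_measure (2 * π) (-π) (measurable_toCircle hs)
  rw [hpre, AddCircle.volume_eq_smul_haarAddCircle, Measure.smul_apply, smul_eq_mul,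
    show -π + 2 * π = π by ring] at hvol
  rw [coe_unitCircleMeasure, Measure.map_apply measurable_toCircle hs,
    ENNReal.eq_div_iff (by simpa using two_pi_pos) ENNReal.ofReal_ne_top, hvol]

theorem ae_norm_eq_one_unitCircleMeasure : ∀ᵐ z ∂(unitCircleMeasure : Measure ℂ), ‖z‖ = 1 := by
  rw [coe_unitCircleMeasure, ae_map_iff measurable_toCircle.aemeasurable
    (measurableSet_eq_fun measurable_norm measurable_const)]
  exact .of_forall fun θ => Circle.norm_coe _

theorem measurePreserving_mul_unitCircleMeasure {w : ℂ} (hw : ‖w‖ = 1) :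
    MeasurePreserving (w * ·) (unitCircleMeasure : Measure ℂ) (unitCircleMeasure : Measure ℂ) := by
  have hcomm : (w * ·) ∘ (fun θ : AddCircle (2 * π) => (θ.toCircle : ℂ)) =
      (fun θ : AddCircle (2 * π) => (θ.toCircle : ℂ)) ∘ (argMod w + ·) := by
    ext θ
    have hw' : ((argMod w).toCircle : ℂ) = w := by simpa [hw] using norm_mul_toCircle_argMod w
    simp [AddCircle.toCircle_add, hw']
  refine ⟨measurable_const_mul w, ?_⟩
  rw [coe_unitCircleMeasure, Measure.map_map (measurable_const_mul w) measurable_toCircle, hcomm,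
    ← Measure.map_map measurable_toCircle (measurable_const_add _), map_add_left_eq_self]

theorem abs_eq_arccos_cos {θ : ℝ} (hθ : |θ| ≤ π) : |θ| = arccos (cos θ) := by
  rw [← cos_abs, arccos_cos (abs_nonneg θ) hθ]

theorem unitCircleMeasure_lt_re (x : ℝ) :
    (unitCircleMeasure : Measure ℂ) {z | x < z.re} = ENNReal.ofReal (arccos x / π) := by
  have subset : {θ : ℝ | x < cos θ} ∩ Set.Ioc (-π) π ⊆ Set.Icc (-arccos x) (arccos x) := by
    rintro θ ⟨hx, hθ⟩
    rw [Set.mem_Icc, ← abs_le, abs_eq_arccos_cos (abs_le.2 ⟨hθ.1.le, hθ.2⟩)]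
    exact arccos_le_arccos hx.le
  have superset : Set.Ioo (-arccos x) (arccos x) ⊆ {θ : ℝ | x < cos θ} ∩ Set.Ioc (-π) π := by
    intro θ hθ
    have hθ' := abs_lt.2 hθ
    have hπ := hθ'.trans_le (arccos_le_pi x)
    refine ⟨show x < cos θ from lt_of_not_ge fun hx => hθ'.not_ge ?_, (abs_lt.1 hπ).1,
      (abs_lt.1 hπ).2.le⟩
    rw [abs_eq_arccos_cos hπ.le]
    exact arccos_le_arccos hx
  have hvol : volume ({θ : ℝ | x < cos θ} ∩ Set.Ioc (-π) π) = ENNReal.ofReal (2 * arccos x) := by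
    refine le_antisymm ((measure_mono subset).trans_eq ?_) (le_trans (le_of_eq ?_)
      (measure_mono superset)) <;> simp [two_mul]
  rw [unitCircleMeasure_apply (measurableSet_lt measurable_const Complex.measurable_re)]
  simp only [Set.mem_ofPred_eq, Circle.coe_exp, Complex.exp_ofReal_mul_I_re]
  rw [hvol, ← ENNReal.ofReal_div_of_pos two_pi_pos, mul_div_mul_left _ _ two_ne_zero]

theorem unitCircleMeasure_re_eq (x : ℝ) : (unitCircleMeasure : Measure ℂ) {z | z.re = x} = 0 := by
  have subset : {θ : ℝ | cos θ = x} ∩ Set.Ioc (-π) π ⊆ {arccos x, -arccos x} := by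
    rintro θ ⟨rfl, hθ⟩
    exact eq_or_eq_neg_of_abs_eq (abs_eq_arccos_cos (abs_le.2 ⟨hθ.1.le, hθ.2⟩))
  rw [unitCircleMeasure_apply (measurableSet_eq_fun Complex.measurable_re measurable_const)]
  simp only [Set.mem_ofPred_eq, Circle.coe_exp, Complex.exp_ofReal_mul_I_re]
  rw [((Set.toFinite _).subset subset).measure_zero, ENNReal.zero_div]

theorem sq_norm_one_add_mul {a z : ℂ} (ha : a ≠ 0) (hz : ‖z‖ = 1) :
    ‖1 + a * z‖ ^ 2 = 1 + 2 * ‖a‖ * ((a / ‖a‖ * z).re - -‖a‖ / 2) := by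
  have hre : (a / ‖a‖ * z).re = (a * z).re / ‖a‖ := by
    rw [div_mul_eq_mul_div, Complex.div_ofReal_re]
  have ha' := norm_ne_zero_iff.2 ha
  rw [hre, ← Complex.normSq_eq_norm_sq, Complex.normSq_add, Complex.normSq_eq_norm_sq (a * z),
    norm_mul, hz, map_one, one_mul, Complex.conj_re, mul_one]
  field_simp
  ring

theorem unitCircleMeasure_one_lt_norm_one_add_mul {a : ℂ} (ha : a ≠ 0) :
    (unitCircleMeasure : Measure ℂ) {z | 1 < ‖1 + a * z‖} =
      ENNReal.ofReal (arccos (-‖a‖ / 2) / π) := by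
  have hrot := measurePreserving_mul_unitCircleMeasure (w := a / ‖a‖) (by simp [ha])
  rw [← unitCircleMeasure_lt_re, ← hrot.measure_preimage
    (measurableSet_lt measurable_const Complex.measurable_re).nullMeasurableSet]
  refine measure_congr (ae_norm_eq_one_unitCircleMeasure.mono fun z hz => propext ?_)
  change 1 < ‖1 + a * z‖ ↔ -‖a‖ / 2 < (a / ‖a‖ * z).re
  rw [← one_lt_sq_iff₀ (norm_nonneg _), sq_norm_one_add_mul ha hz, lt_add_iff_pos_right,
    mul_pos_iff_of_pos_left (by simpa using ha), sub_pos]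

theorem unitCircleMeasure_norm_one_add_mul_eq_one {a : ℂ} (ha : a ≠ 0) :
    (unitCircleMeasure : Measure ℂ) {z | ‖1 + a * z‖ = 1} = 0 := by
  have hrot := measurePreserving_mul_unitCircleMeasure (w := a / ‖a‖) (by simp [ha])
  rw [← unitCircleMeasure_re_eq (-‖a‖ / 2), ← hrot.measure_preimage
    (measurableSet_eq_fun Complex.measurable_re measurable_const).nullMeasurableSet]
  refine measure_congr (ae_norm_eq_one_unitCircleMeasure.mono fun z hz => propext ?_)
  change ‖1 + a * z‖ = 1 ↔ (a / ‖a‖ * z).re = -‖a‖ / 2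
  rw [← pow_eq_one_iff_of_nonneg (norm_nonneg _) two_ne_zero, sq_norm_one_add_mul ha hz,
    add_eq_left, mul_eq_zero_iff_left (by simpa using ha), sub_eq_zero]

theorem unitCircleMeasure_frontier_one_lt_norm_one_add_mul {a : ℂ} (ha : a ≠ 0) :
    (unitCircleMeasure : Measure ℂ) (frontier {z | 1 < ‖1 + a * z‖}) = 0 :=
  measure_mono_null (fun _ hz => (frontier_lt_subset_eq (by fun_prop) (by fun_prop) hz).symm)
    (unitCircleMeasure_norm_one_add_mul_eq_one ha)

end UnitCircle

section EmpiricalMeasure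

variable {α : Type*} [MeasurableSpace α] {s : Multiset α} (hs : s ≠ 0)

theorem toMeasure_ofMultiset_setOf {p : α → Prop} [DecidablePred p] (hp : MeasurableSet {x | p x}) :
    (PMF.ofMultiset s hs).toMeasure {x | p x} = (s.filter p).card / s.card := by
  classical
  rw [PMF.toMeasure_ofMultiset_apply hs _ hp,
    tsum_eq_sum (s := (s.filter p).toFinset) fun x hx => by simpa using hx, ← Nat.cast_sum]
  simp only [Set.mem_ofPred_eq]
  rw [← Multiset.toFinset_sum_count_eq (s.filter p)]

variable [MeasurableSingletonClass α]

theorem ae_mem_toMeasure_ofMultiset : ∀ᵐ x ∂(PMF.ofMultiset s hs).toMeasure, x ∈ s := by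
  classical
  have h := ae_restrict_mem (μ := (PMF.ofMultiset s hs).toMeasure)
    (PMF.ofMultiset s hs).support_countable.measurableSet
  rw [PMF.restrict_toMeasure_support] at h
  simpa using h

theorem integral_toMeasure_ofMultiset {E : Type*} [NormedAddCommGroup E] [NormedSpace ℝ E]
    [CompleteSpace E] (f : α → E) :
    ∫ x, f x ∂(PMF.ofMultiset s hs).toMeasure = (s.card : ℝ)⁻¹ • (s.map f).sum := by
  classical
  rw [← PMF.restrict_toMeasure_support, PMF.support_ofMultiset, setIntegral_finset _ .finset,
    Finset.sum_multiset_map_count, Finset.smul_sum]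
  refine Finset.sum_congr rfl fun x _ => ?_
  rw [measureReal_def, PMF.toMeasure_apply_singleton _ _ (measurableSet_singleton x),
    PMF.ofMultiset_apply, ENNReal.toReal_div, ENNReal.toReal_natCast, ENNReal.toReal_natCast,
    div_eq_inv_mul, mul_smul, Nat.cast_smul_eq_nsmul]

end EmpiricalMeasure

section PowerSums

theorem sum_map_pow_eq_zero_of_esymm_eq_zero {R : Type*} [CommRing R] {s : Multiset R} {k : ℕ}
    (hk : 0 < k) (h : ∀ i, 0 < i → i ≤ k → s.esymm i = 0) : (s.map (· ^ k)).sum = 0 := by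
  classical
  have esymm_eq (i : ℕ) : MvPolynomial.aeval (fun x : s => (x : R)) (MvPolynomial.esymm s R i) =
      s.esymm i := by
    rw [MvPolynomial.aeval_esymm_eq_multiset_esymm, Multiset.map_univ_coe]
  have psum_eq : MvPolynomial.aeval (fun x : s => (x : R)) (MvPolynomial.psum s R k) =
      (s.map (· ^ k)).sum := by
    rw [MvPolynomial.psum, map_sum]
    simp only [map_pow, MvPolynomial.aeval_X]
    exact congrArg Multiset.sum (Multiset.map_univ s (· ^ k))
  rw [← psum_eq, MvPolynomial.psum_eq_mul_esymm_sub_sum s R k hk, map_sub, map_mul, map_sum,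
    esymm_eq, h k hk le_rfl, mul_zero, zero_sub, neg_eq_zero]
  refine Finset.sum_eq_zero fun ij hij => ?_
  obtain ⟨-, hpos, hlt⟩ := Finset.mem_filter.1 hij
  rw [map_mul, map_mul, esymm_eq, h ij.1 hpos hlt.le, mul_zero, zero_mul]

theorem sum_roots_pow_eq_zero {R : Type*} [CommRing R] [IsDomain R] {p : R[X]} (hp : p ≠ 0)
    (hroots : p.roots.card = p.natDegree) {k : ℕ} (hk : 0 < k)
    (hcoeff : ∀ i < p.natDegree, p.natDegree ≤ i + k → p.coeff i = 0) :
    (p.roots.map (· ^ k)).sum = 0 := by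
  refine sum_map_pow_eq_zero_of_esymm_eq_zero hk fun i hi hik => ?_
  obtain hlt | hle := lt_or_ge p.natDegree i
  · simp [Multiset.esymm, Multiset.powersetCard_eq_empty i (hroots ▸ hlt)]
  · have vieta := coeff_eq_esymm_roots_of_card hroots (Nat.sub_le p.natDegree i)
    rw [hcoeff _ (by omega) (by omega), Nat.sub_sub_self hle] at vieta
    simpa [hp] using vieta.symm

end PowerSums

theorem sum_abs_sub_one_le_of_one_le_prod {s : Multiset ℝ} {b : ℝ} (hb : 0 ≤ b)
    (hpos : ∀ x ∈ s, 0 < x) (hle : ∀ x ∈ s, x ≤ 1 + b) (hprod : 1 ≤ s.prod) :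
    (s.map fun x => |x - 1|).sum ≤ s.card * (2 * b) := by
  have abs_le_sub_log (x : ℝ) (hx : x ∈ s) : |x - 1| ≤ 2 * b - log x := by
    have hlog := log_le_sub_one_of_pos (hpos x hx)
    have := hle x hx
    exact abs_le.2 ⟨by linarith, by linarith⟩
  calc (s.map fun x => |x - 1|).sum
      ≤ (s.map fun x => 2 * b - log x).sum := Multiset.sum_map_le_sum_map _ _ abs_le_sub_log
    _ = s.card * (2 * b) - log s.prod := by
      rw [Multiset.sum_map_sub, log_multiset_prod fun x hx => (hpos x hx).ne']; simp
    _ ≤ s.card * (2 * b) := sub_le_self _ (log_nonneg hprod)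

theorem mul_norm_sub_one_le_of_pow_succ_eq {K : Type*} [NormedDivisionRing K] {m : ℕ} {a z : K}
    (h : z ^ (m + 1) = 1 + a * z) : m * (‖z‖ - 1) ≤ ‖a‖ := by
  obtain hz | hz := le_total ‖z‖ 1
  · exact (mul_nonpos_of_nonneg_of_nonpos (by positivity) (by linarith)).trans (norm_nonneg a)
  · have bernoulli : 1 + m * (‖z‖ - 1) ≤ ‖z‖ ^ m := one_add_mul_sub_le_pow (by linarith) m
    have hpow : ‖z‖ ^ m * ‖z‖ ≤ 1 + ‖a‖ * ‖z‖ := by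
      rw [← pow_succ, ← norm_pow, h, ← norm_mul]
      simpa using norm_add_le 1 (a * z)
    nlinarith [norm_nonneg a]

section Trinomial

variable {n : ℕ} {a : ℝ}

theorem trinomial_monic (hn : 2 ≤ n) : (trinomial n a).Monic := by
  rw [_root_.trinomial, sub_sub]
  exact monic_X_pow_sub (lt_of_le_of_lt (b := 1) (by compute_degree) (by exact_mod_cast hn))

theorem natDegree_trinomial (hn : 2 ≤ n) : (trinomial n a).natDegree = n := by
  rw [_root_.trinomial, sub_sub, natDegree_sub_eq_left_of_natDegree_lt, natDegree_X_pow]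
  rw [natDegree_X_pow]
  exact lt_of_le_of_lt (b := 1) (by compute_degree) hn

theorem card_roots_trinomial (hn : 2 ≤ n) : (trinomial n a).roots.card = n :=
  (splits_iff_card_roots.1 (IsAlgClosed.splits _)).trans (natDegree_trinomial hn)

theorem roots_trinomial_ne_zero (hn : 2 ≤ n) : (trinomial n a).roots ≠ 0 := by
  rw [← Multiset.card_pos, card_roots_trinomial hn]
  omega

theorem coeff_trinomial_eq_zero {i : ℕ} (hi : 1 < i) (hin : i ≠ n) :
    (trinomial n a).coeff i = 0 := by
  simp [_root_.trinomial, coeff_X_pow, coeff_X, coeff_one, hin, hi.ne, (zero_lt_one.trans hi).ne']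

theorem sum_roots_trinomial_pow {k : ℕ} (hk : 0 < k) (hkn : k + 2 ≤ n) :
    ((trinomial n a).roots.map (· ^ k)).sum = 0 := by
  have hn : 2 ≤ n := by omega
  refine sum_roots_pow_eq_zero (trinomial_monic hn).ne_zero
    (splits_iff_card_roots.1 (IsAlgClosed.splits _)) hk fun i hlt hle => ?_
  rw [natDegree_trinomial hn] at hlt hle
  exact coeff_trinomial_eq_zero (by omega) hlt.ne

theorem pow_eq_of_mem_roots_trinomial {z : ℂ} (hz : z ∈ (trinomial n a).roots) :
    z ^ n = 1 + a * z := by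
  have := (mem_roots'.1 hz).2
  simp only [_root_.trinomial, IsRoot.def, eval_sub, eval_pow, eval_X, eval_mul, eval_C,
    eval_one] at this
  linear_combination this

theorem prod_norm_roots_trinomial (hn : 2 ≤ n) : ((trinomial n a).roots.map (‖·‖)).prod = 1 := by
  have coeff_zero : (trinomial n a).coeff 0 = -1 := by
    simp [_root_.trinomial, coeff_X_pow, (two_pos.trans_le hn).ne]
  have vieta := congrArg norm <| coeff_zero.symm.trans <|
    (IsAlgClosed.splits (trinomial n a)).coeff_zero_eq_prod_roots_of_monic (trinomial_monic hn)
  calc ((trinomial n a).roots.map (‖·‖)).prod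
      = ‖(trinomial n a).roots.prod‖ := Multiset.prod_hom _ (normHom : ℂ →*₀ ℝ)
    _ = 1 := by simpa using vieta.symm

theorem norm_le_of_mem_roots_trinomial {z : ℂ} (hz : z ∈ (trinomial (n + 2) a).roots) :
    ‖z‖ ≤ 1 + |a| / (n + 1) := by
  have h := mul_norm_sub_one_le_of_pow_succ_eq (pow_eq_of_mem_roots_trinomial hz)
  rw [← sub_le_iff_le_add', le_div_iff₀' (by positivity)]
  simpa using h

theorem ne_zero_of_mem_roots_trinomial {z : ℂ} (hz : z ∈ (trinomial (n + 2) a).roots) : z ≠ 0 := by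
  rintro rfl
  simpa using pow_eq_of_mem_roots_trinomial hz

theorem sum_abs_norm_roots_trinomial_sub_one_le :
    ((trinomial (n + 2) a).roots.map fun z => |‖z‖ - 1|).sum ≤
      (trinomial (n + 2) a).roots.card * (2 * (|a| / (n + 1))) := by
  have h := sum_abs_sub_one_le_of_one_le_prod
    (s := (trinomial (n + 2) a).roots.map (‖·‖)) (b := |a| / (n + 1)) (by positivity)
    (Multiset.forall_mem_map_iff.2 fun z hz => norm_pos_iff.2 (ne_zero_of_mem_roots_trinomial hz))
    (Multiset.forall_mem_map_iff.2 fun z hz => norm_le_of_mem_roots_trinomial hz)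
    (prod_norm_roots_trinomial (by omega)).ge
  simpa only [Multiset.map_map, Multiset.card_map, Function.comp_def] using h

theorem one_lt_norm_iff_of_mem_roots_trinomial {z : ℂ} (hn : n ≠ 0)
    (hz : z ∈ (trinomial n a).roots) : 1 < ‖z‖ ↔ 1 < ‖1 + a * z‖ := by
  rw [← pow_eq_of_mem_roots_trinomial hz, norm_pow, one_lt_pow_iff_of_nonneg (norm_nonneg z) hn]

/-- The uniform probability measure on the roots of `x ^ (n + 2) - a x - 1`, counted with
multiplicity; the exponent is shifted so that there always are roots. -/
noncomputable def rootMeasure (a : ℝ) (n : ℕ) : ProbabilityMeasure ℂ :=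
  ⟨(PMF.ofMultiset (trinomial (n + 2) a).roots (roots_trinomial_ne_zero (by omega))).toMeasure,
    inferInstance⟩

theorem tendsto_rootMeasure (a : ℝ) : Tendsto (rootMeasure a) atTop (𝓝 unitCircleMeasure) := by
  refine tendsto_unitCircleMeasure (R := 1 + |a|) (fun n => ?_) ?_ fun k hk => ?_
  · filter_upwards [ae_mem_toMeasure_ofMultiset _] with z hz
    refine (norm_le_of_mem_roots_trinomial hz).trans ?_
    gcongr
    exact div_le_self (abs_nonneg a) (by simp)
  · have hlim : Tendsto (fun n : ℕ => 2 * (|a| / (n + 1))) atTop (𝓝 0) := by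
      simpa using ((tendsto_const_div_atTop_nhds_zero_nat |a|).comp
        (tendsto_add_atTop_nat 1)).const_mul 2
    refine squeeze_zero (fun n => integral_nonneg fun z => abs_nonneg _) (fun n => ?_) hlim
    have hcard : 0 < ((trinomial (n + 2) a).roots.card : ℝ) :=
      Nat.cast_pos.2 (Multiset.card_pos.2 (roots_trinomial_ne_zero (by omega)))
    rw [rootMeasure, ProbabilityMeasure.coe_mk, integral_toMeasure_ofMultiset, smul_eq_mul,
      inv_mul_le_iff₀ hcard]
    exact sum_abs_norm_roots_trinomial_sub_one_le
  · refine tendsto_const_nhds.congr' ?_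
    filter_upwards [eventually_ge_atTop k] with n hn
    rw [rootMeasure, ProbabilityMeasure.coe_mk, integral_toMeasure_ofMultiset,
      sum_roots_trinomial_pow (Nat.pos_of_ne_zero hk) (by omega), smul_zero]

theorem rootMeasure_one_lt_norm_one_add_mul (a : ℝ) (n : ℕ) :
    (rootMeasure a n : Measure ℂ).real {z | 1 < ‖1 + a * z‖} = nu (n + 2) a / (n + 2 : ℕ) := by
  have hmeas : MeasurableSet {z : ℂ | 1 < ‖1 + a * z‖} :=
    measurableSet_lt measurable_const (by fun_prop)
  rw [rootMeasure, ProbabilityMeasure.coe_mk, measureReal_def, toMeasure_ofMultiset_setOf _ hmeas,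
    ENNReal.toReal_div, ENNReal.toReal_natCast, ENNReal.toReal_natCast,
    card_roots_trinomial (by omega), nu, Multiset.filter_congr fun z hz =>
      one_lt_norm_iff_of_mem_roots_trinomial (by omega) hz]

end Trinomial

theorem arccos_neg_min_div_two (x : ℝ) : arccos (-min x 2 / 2) = arccos (-x / 2) := by
  obtain hx | hx := le_total x 2
  · rw [min_eq_left hx]
  · rw [min_eq_right hx, arccos_of_le_neg_one (by norm_num), arccos_of_le_neg_one (by linarith)]

theorem theorem1p1_general (a : ℝ) (ha : a ≠ 0) :
    Tendsto (fun n : ℕ => (nu n a : ℝ) / (n : ℝ)) atTop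
      (𝓝 (1 / π * arccos (-min |a| 2 / 2))) := by
  have ha' : (a : ℂ) ≠ 0 := Complex.ofReal_ne_zero.2 ha
  have hlim := (ENNReal.tendsto_toReal (measure_ne_top _ _)).comp <|
    ProbabilityMeasure.tendsto_measure_of_null_frontier_of_tendsto' (tendsto_rootMeasure a)
      (unitCircleMeasure_frontier_one_lt_norm_one_add_mul ha')
  rw [unitCircleMeasure_one_lt_norm_one_add_mul ha', ENNReal.toReal_ofReal
    (div_nonneg (arccos_nonneg _) pi_pos.le)] at hlim
  rw [← tendsto_add_atTop_iff_nat 2, one_div_mul_eq_div, arccos_neg_min_div_two,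
    ← norm_eq_abs, ← Complex.norm_real]
  exact hlim.congr (rootMeasure_one_lt_norm_one_add_mul a)

theorem theorem1p1 (a : ℝ) (ha : a ∈ Set.Ioc (0 : ℝ) 2) :
    Tendsto (fun n : ℕ => (nu n a : ℝ) / (n : ℝ)) atTop
      (𝓝 (1 / Real.pi * Real.arccos (-a / 2))) := by
  simpa only [abs_of_pos ha.1, min_eq_left ha.2] using theorem1p1_general a ha.1.ne'
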